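/- Conventions. All Hilbert spaces are finite-dimensional; a quantum operation is a completely positive trace preserving linear map. A quantum operation $\mathcal E$ from operators on $\mathcal H$ to operators on $\mathcal K$ is reversible if there is a quantum operation $\mathcal R$ with $\mathcal R(\mathcal E(\rho))=\rho$ for all density operators $\rho$ on $\mathcal H$; it is vanishing if there is a density operator $\rho_0$ on $\mathcal K$ with $\mathcal E(\rho)=\rho_0$ for all density operators $\rho$ on $\mathcal H$. A quantum secret sharing (QSS) scheme with secret space $\mathcal H$ and shares $\mathcal H_1,\dots,\mathcal H_n$ is a reversible quantum operation $W$ from operators on $\mathcal H$ to operators on $\mathcal H_1\otimes\dots\otimes\mathcal H_n$. It is a pure state scheme if it maps pure states to pure states. A set $X\subseteq N=\{1,\dots,n\}$ is qualified (forbidden) if $W_X=\mathrm{Tr}_{N\setminus X}\circ W$ is reversible (vanishing), and intermediate if it is neither. $W$ is a $(k,L,n)$-threshold ramp QSS scheme if $X$ is forbidden iff $|X|\le k-L$ and $X$ is qualified iff $|X|\ge k$. Statement. Let $1\le L\le k$ and $n=2k-L$, and let $\mathbb F$ be a finite field with $q=|\mathbb F|\ge n$. Let $\mathbb C^{\mathbb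 F}$ have the orthonormal basis $\{|s\rangle\}_{s\in\mathbb F}$, let the secret space be $\mathcal H=(\mathbb C^{\mathbb F})^{\otimes L}$ and let every share be $\mathcal H_i=\mathbb C^{\mathbb F}$, $i=1,\dots,n$. For $c=(c_1,\dots,c_k)\in\mathbb F^k$ put $p_c(t)=\sum_{i=1}^k c_i t^{i-1}$. Let $x_1,\dots,x_n\in\mathbb F$ be distinct. (1) Suppose that $L=k$ or that all $x_i$ are nonzero. Define $$V|s_1,\dots,s_L\rangle=q^{-(k-L)/2}\sum_{c\in\mathbb F^k,\ c_j=s_j\ (1\le j\le L)}|p_c(x_1),\dots,p_c(x_n)\rangle .$$ Then $V$ is an isometry, and $W(\rho)=V\rho V^*$ is a pure state $(k,L,n)$-threshold ramp QSS scheme: $X$ is qualified iff $|X|\ge k$, forbidden iff $|X|\le k-L$, and intermediate iff $k-L<|X|<k$. (2) Without the condition that the $x_i$ are nonzero, the same conclusions hold for the map $V$ defined in the same way with the secret in the last $L$ coefficients, that is, with the sum over all $c\in\mathbb F^k$ such that $c_{k-L+j}=s_j$ for $1\le j\le L$. (3) The secret has dimension $q^L$ and each share has dimension $q$. This is optimal: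 every $(k,L,n)$-threshold ramp QSS scheme (pure or mixed, with arbitrary secret space $\mathcal H$ and shares $\mathcal H_i$) satisfies $$\frac1L\log\dim\mathcal H\le\frac1n\sum_{i=1}^n\log\dim\mathcal H_i,$$ and the schemes in (1) and (2) attain equality. -/

import Mathlib

/-!
Every finite-dimensional Hilbert space is `ℂ^ι` for a finite set `ι` indexing an orthonormal basis,
operators on it are matrices, and a tensor product of such spaces is indexed by the product of the
index sets.
-/

noncomputable section

open scoped Matrix ComplexOrder

namespace RampQSS

/-- The dimension of the Hilbert space with an orthonormal basis indexed by `ι`. -/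
def hilbertDim (ι : Type*) [Fintype ι] : ℕ :=
  Module.finrank ℂ (EuclideanSpace ℂ ι)

/-- The density operators: positive semidefinite operators of trace one. -/
def densityOperators (ι : Type*) [Fintype ι] : Set (Matrix ι ι ℂ) :=
  {ρ | ρ.PosSemidef ∧ ρ.trace = 1}

/-- The pure states `|v⟩⟨v|`, where `v` is a unit vector. -/
def pureStates (ι : Type*) [Fintype ι] : Set (Matrix ι ι ℂ) :=
  {ρ | ∃ v : ι → ℂ, star v ⬝ᵥ v = 1 ∧ ρ = Matrix.vecMulVec v (star v)}

section Operations

variable {ι κ : Type*} [Fintype ι] [Fintype κ]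

/-- The map `id ⊗ Φ` on `ℂ^m ⊗ ℂ^ι`: apply `Φ` to each of the `m × m` blocks. -/
def ampliation (m : ℕ) (Φ : Matrix ι ι ℂ →ₗ[ℂ] Matrix κ κ ℂ)
    (M : Matrix (Fin m × ι) (Fin m × ι) ℂ) : Matrix (Fin m × κ) (Fin m × κ) ℂ :=
  Matrix.of fun p r => Φ (Matrix.of fun i j => M (p.1, i) (r.1, j)) p.2 r.2

/-- Quantum operations: completely positive and trace preserving maps. -/
structure IsQuantumOperation (Φ : Matrix ι ι ℂ →ₗ[ℂ] Matrix κ κ ℂ) : Prop where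
  completelyPositive : ∀ (m : ℕ) (M : Matrix (Fin m × ι) (Fin m × ι) ℂ),
    M.PosSemidef → (ampliation m Φ M).PosSemidef
  tracePreserving : ∀ A : Matrix ι ι ℂ, (Φ A).trace = A.trace

/-- `Φ` is reversible with respect to `S`: some quantum operation undoes it on `S`. -/
def IsReversible (Φ : Matrix ι ι ℂ →ₗ[ℂ] Matrix κ κ ℂ) (S : Set (Matrix ι ι ℂ)) : Prop :=
  ∃ R : Matrix κ κ ℂ →ₗ[ℂ] Matrix ι ι ℂ, IsQuantumOperation R ∧ ∀ ρ ∈ S, R (Φ ρ) = ρ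

/-- `Φ` is vanishing with respect to `S`: it sends all of `S` to one density operator. -/
def IsVanishing (Φ : Matrix ι ι ℂ →ₗ[ℂ] Matrix κ κ ℂ) (S : Set (Matrix ι ι ℂ)) : Prop :=
  ∃ ρ₀ ∈ densityOperators κ, ∀ ρ ∈ S, Φ ρ = ρ₀

/-- The map `ρ ↦ V ρ V*`. -/
def conjugation (V : Matrix κ ι ℂ) : Matrix ι ι ℂ →ₗ[ℂ] Matrix κ κ ℂ where
  toFun ρ := V * ρ * Vᴴ
  map_add' ρ τ := by rw [Matrix.mul_add, Matrix.add_mul]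
  map_smul' a ρ := by simp

end Operations

section Shares

variable {N : Type*} [Fintype N] [DecidableEq N] {σ : Type*} [Fintype σ]
  {κ : N → Type*} [∀ i, Fintype (κ i)]

/-- The partial trace over the complement of `X`, from operators on `⨂ i, ℂ^(κ i)` to operators
on `⨂ i ∈ X, ℂ^(κ i)`. -/
def partialTrace (X : Finset N) :
    Matrix (∀ i, κ i) (∀ i, κ i) ℂ →ₗ[ℂ]
      Matrix (∀ i : {i // i ∈ X}, κ i) (∀ i : {i // i ∈ X}, κ i) ℂ where
  toFun ρ := Matrix.of fun a b => ∑ z : (∀ i : {i // i ∉ X}, κ i),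
    ρ ((Equiv.piEquivPiSubtypeProd (· ∈ X) κ).symm (a, z))
      ((Equiv.piEquivPiSubtypeProd (· ∈ X) κ).symm (b, z))
  map_add' ρ τ := by ext a b; simp [Finset.sum_add_distrib]
  map_smul' c ρ := by ext a b; simp [Finset.mul_sum]

/-- A QSS scheme with secret space `ℂ^σ` and shares `ℂ^(κ i)`, `i ∈ N`. -/
def IsQSSScheme (W : Matrix σ σ ℂ →ₗ[ℂ] Matrix (∀ i, κ i) (∀ i, κ i) ℂ) : Prop :=
  IsQuantumOperation W ∧ IsReversible W (densityOperators σ)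

/-- A pure state scheme: a QSS scheme that sends pure states to pure states. -/
def IsPureStateScheme (W : Matrix σ σ ℂ →ₗ[ℂ] Matrix (∀ i, κ i) (∀ i, κ i) ℂ) : Prop :=
  IsQSSScheme W ∧ ∀ ρ ∈ pureStates σ, W ρ ∈ pureStates (∀ i, κ i)

/-- The shares in `X` determine the secret state. -/
def IsQualified (W : Matrix σ σ ℂ →ₗ[ℂ] Matrix (∀ i, κ i) (∀ i, κ i) ℂ) (X : Finset N) : Prop :=
  IsReversible (partialTrace X ∘ₗ W) (densityOperators σ)

/-- The shares in `X` carry no information on the secret state. -/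
def IsForbidden (W : Matrix σ σ ℂ →ₗ[ℂ] Matrix (∀ i, κ i) (∀ i, κ i) ℂ) (X : Finset N) : Prop :=
  IsVanishing (partialTrace X ∘ₗ W) (densityOperators σ)

/-- Neither qualified nor forbidden. -/
def IsIntermediate (W : Matrix σ σ ℂ →ₗ[ℂ] Matrix (∀ i, κ i) (∀ i, κ i) ℂ) (X : Finset N) :
    Prop :=
  ¬ IsQualified W X ∧ ¬ IsForbidden W X

/-- A `(k, L, n)`-threshold ramp QSS scheme, where `n = |N|`: the forbidden sets are those of size
at most `k - L` (written without subtraction), the qualified sets those of size at least `k`. -/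
structure IsThresholdRampScheme (k L : ℕ)
    (W : Matrix σ σ ℂ →ₗ[ℂ] Matrix (∀ i, κ i) (∀ i, κ i) ℂ) : Prop where
  isQSSScheme : IsQSSScheme W
  forbidden_iff : ∀ X : Finset N, IsForbidden W X ↔ X.card + L ≤ k
  qualified_iff : ∀ X : Finset N, IsQualified W X ↔ k ≤ X.card

end Shares

section Construction

variable {F : Type*} [Field F] [Fintype F] [DecidableEq F] {k L n : ℕ}

/-- `p_c(t) = c₀ + c₁ t + ⋯ + c_{k-1} t^{k-1}`. -/
def polyEval (c : Fin k → F) (t : F) : F :=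
  ∑ i : Fin k, c i * t ^ (i : ℕ)

/-- The first `L` of the `k` coefficient positions. -/
def firstPositions (h : L ≤ k) : Fin L → Fin k :=
  fun j => ⟨j, by omega⟩

/-- The last `L` of the `k` coefficient positions, in increasing order. -/
def lastPositions (h : L ≤ k) : Fin L → Fin k :=
  fun j => ⟨k - L + j, by omega⟩

/-- The coefficient vectors in `F^k` that carry `s ∈ F^L` in the positions `pos`. -/
def coefficientSet (pos : Fin L → Fin k) (s : Fin L → F) : Finset (Fin k → F) :=
  Finset.univ.filter fun c => ∀ j, c (pos j) = s j

/-- The vector `q^{-(k-L)/2} ∑_c |p_c(x_1), …, p_c(x_n)⟩`, where `c` runs through the coefficient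
vectors that carry `s` in the positions `pos`. -/
def encodedVector (pos : Fin L → Fin k) (x : Fin n → F) (s : Fin L → F) : (Fin n → F) → ℂ :=
  ((1 / Real.sqrt ((Fintype.card F : ℝ) ^ (k - L)) : ℝ) : ℂ) •
    ∑ c ∈ coefficientSet pos s, Pi.single (fun i => polyEval c (x i)) (1 : ℂ)

/-- The linear map `V` with `V |s⟩ = encodedVector pos x s`. -/
def encoder (pos : Fin L → Fin k) (x : Fin n → F) : Matrix (Fin n → F) (Fin L → F) ℂ :=
  Matrix.of fun y s => encodedVector pos x s y

/-- `V` is an isometry from `(ℂ^F)^{⊗L}` to `(ℂ^F)^{⊗n}`, and `ρ ↦ V ρ V*` is a pure state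
`(k, L, n)`-threshold ramp QSS scheme, whose intermediate sets are those `X` with
`k - L < |X| < k`. -/
structure IsPureRampEncoding (k L : ℕ) (V : Matrix (Fin n → F) (Fin L → F) ℂ) : Prop where
  isometry : Vᴴ * V = 1
  pureStateScheme : IsPureStateScheme (κ := fun _ : Fin n => F) (conjugation V)
  thresholdRamp : IsThresholdRampScheme (κ := fun _ : Fin n => F) k L (conjugation V)
  intermediate_iff : ∀ X : Finset (Fin n),
    IsIntermediate (κ := fun _ : Fin n => F) (conjugation V) X ↔ k < X.card + L ∧ X.card < k

end Construction

end RampQSS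

end

/-! The encoder sends `|s⟩` to a uniform superposition of codewords `E c` over the coefficient
vectors `c` with secret part `π c = s`. Everything rests on two facts about polynomials of degree
less than `k`: any `k` values determine `c`, and the secret together with any `k - L` values can be
prescribed freely.

If `|X| ≥ k`, the complement of `X` has at most `k - L` elements and lies in some `Z` of size `k -
L`. The shares in `X` determine `c`, so they can be relabelled as the pair (secret, values on `Z`).
Since the second entry fixes everything outside `X`, discarding it leaves the secret state intact
(`isQualified_superposition`). If `|X| ≤ k - L`, the complement has at least `k` shares and
determines `c`, so tracing it out kills all coherences; the remaining mixture is uniform for every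
secret (`isForbidden_superposition`).

Sharpness of both thresholds and the optimality bound come from one inequality: if a forbidden `A`
lies in a qualified `X`, the secret is no larger than the shares in `X \ A`
(`card_le_prod_card_of_isForbidden_of_isQualified`). It is proved without entropies, by applying `M
≤ d · Tr_τ M ⊗ 1` to half of a maximally entangled state. Averaging it over cyclic windows of `L`
shares gives the bound on the dimensions. -/

noncomputable section

open scoped Matrix ComplexOrder

namespace RampQSS

/-! ### Kraus maps and channels given by relabelling basis states -/

section Channels

variable {ι κ μ : Type*} [Fintype ι] [Fintype κ] [Fintype μ]

theorem IsQuantumOperation.comp {Ψ : Matrix κ κ ℂ →ₗ[ℂ] Matrix μ μ ℂ}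
    {Φ : Matrix ι ι ℂ →ₗ[ℂ] Matrix κ κ ℂ} (hΨ : IsQuantumOperation Ψ)
    (hΦ : IsQuantumOperation Φ) : IsQuantumOperation (Ψ ∘ₗ Φ) where
  completelyPositive m M hM := hΨ.completelyPositive m _ (hΦ.completelyPositive m M hM)
  tracePreserving A := (hΨ.tracePreserving _).trans (hΦ.tracePreserving A)

/-- A map with a Kraus decomposition is a quantum operation. -/
theorem isQuantumOperation_of_kraus [DecidableEq ι] {Φ : Matrix ι ι ℂ →ₗ[ℂ] Matrix κ κ ℂ}
    (K : μ → Matrix κ ι ℂ) (hΦ : ∀ ρ, Φ ρ = ∑ z, K z * ρ * (K z)ᴴ)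
    (hK : ∑ z, (K z)ᴴ * K z = 1) : IsQuantumOperation Φ where
  completelyPositive m M hM := by
    -- The Kraus operators of `id ⊗ Φ` are `1 ⊗ K z`.
    have key : ampliation m Φ M = ∑ z,
        (Matrix.of fun (p : Fin m × κ) (q : Fin m × ι) => if p.1 = q.1 then K z p.2 q.2 else 0) * M *
        (Matrix.of fun (p : Fin m × κ) (q : Fin m × ι) =>
          if p.1 = q.1 then K z p.2 q.2 else 0)ᴴ := by
      ext p r
      simp [ampliation, hΦ, Matrix.sum_apply, Matrix.mul_apply, Fintype.sum_prod_type,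
        ite_mul, mul_ite, apply_ite (starRingEnd ℂ), Finset.sum_ite_irrel]
    rw [key]
    exact Matrix.posSemidef_sum _ fun z _ => hM.mul_mul_conjTranspose_same _
  tracePreserving A := by
    have h : ∀ z, (K z * A * (K z)ᴴ).trace = ((K z)ᴴ * K z * A).trace := fun z => by
      rw [Matrix.mul_assoc, Matrix.trace_mul_comm, Matrix.mul_assoc, Matrix.trace_mul_comm]
    rw [hΦ, Matrix.trace_sum, Finset.sum_congr rfl fun z _ => h z, ← Matrix.trace_sum,
      ← Finset.sum_mul, hK, Matrix.one_mul]

theorem isQuantumOperation_conjugation [DecidableEq ι] {V : Matrix κ ι ℂ} (hV : Vᴴ * V = 1) :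
    IsQuantumOperation (conjugation V) :=
  isQuantumOperation_of_kraus (fun _ : Unit => V) (fun ρ => by simp [conjugation]) (by simpa using hV)

/-- Embed `ℂ^ι` into `ℂ^κ ⊗ ℂ^μ` by `j`, and trace out the second factor. -/
def embeddingChannel [DecidableEq κ] [DecidableEq μ] (j : ι → κ × μ) :
    Matrix ι ι ℂ →ₗ[ℂ] Matrix κ κ ℂ :=
  ∑ z, conjugation (Matrix.of fun b a => if j a = (b, z) then 1 else 0)

variable [DecidableEq ι] [DecidableEq κ] [DecidableEq μ]

/-- Injectivity of `j` makes the images of distinct basis vectors orthogonal, which is the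
completeness relation of the Kraus operators. Both the partial trace and the recovery map are of
this form. -/
theorem isQuantumOperation_embeddingChannel {j : ι → κ × μ} (hj : Function.Injective j) :
    IsQuantumOperation (embeddingChannel j) := by
  refine isQuantumOperation_of_kraus
    (fun z => Matrix.of fun b a => if j a = (b, z) then (1 : ℂ) else 0)
    (fun ρ => by simp [embeddingChannel, conjugation]) ?_
  ext a a'
  have h : ∀ z b, (if j a = (b, z) ∧ j a' = (b, z) then (1 : ℂ) else 0)
      = if a = a' then (if j a = (b, z) then 1 else 0) else 0 := by
    intro z b
    by_cases haa : a = a'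
    · subst haa; simp
    · have : ¬ (j a = (b, z) ∧ j a' = (b, z)) := fun h => haa (hj (h.1.trans h.2.symm))
      simp [haa, this]
  have h2 : ∑ z, ∑ b, (if j a = (b, z) then (1 : ℂ) else 0) = 1 := by
    rw [Finset.sum_comm, ← Fintype.sum_prod_type' (f := fun b z => if j a = (b, z) then (1 : ℂ) else 0)]
    simp
  have h3 : ∀ z b, (starRingEnd ℂ) (if j a = (b, z) then (1 : ℂ) else 0) *
      (if j a' = (b, z) then (1 : ℂ) else 0) = if a = a' then (if j a = (b, z) then 1 else 0) else 0 := by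
    intro z b
    rw [← h]
    by_cases h1 : j a = (b, z) <;> by_cases h2 : j a' = (b, z) <;> simp [h1, h2]
  simp only [Matrix.sum_apply, Matrix.mul_apply, Matrix.conjTranspose_apply, Matrix.of_apply,
    Complex.star_def, h3, Matrix.one_apply]
  split_ifs with haa
  · exact h2
  · simp

theorem embeddingChannel_apply {ι κ μ : Type*} [Fintype ι] [Fintype μ] [DecidableEq κ]
    [DecidableEq μ] (j : ι → κ × μ) (ρ : Matrix ι ι ℂ) (b b' : κ) :
    embeddingChannel j ρ b b' =
      ∑ z, ∑ a', (∑ a, if j a = (b, z) then ρ a a' else 0) * if j a' = (b', z) then 1 else 0 := by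
  simp [embeddingChannel, conjugation, Matrix.sum_apply, Matrix.mul_apply,
    apply_ite (starRingEnd ℂ)]

/-- Discarding the second label destroys coherence between basis states on which it differs and
keeps all other coherence. -/
theorem embeddingChannel_single {ι κ μ : Type*} [Fintype ι] [Fintype μ] [DecidableEq ι]
    [DecidableEq κ] [DecidableEq μ] (j : ι → κ × μ) (a a' : ι) :
    embeddingChannel j (Matrix.single a a' 1) =
      if (j a).2 = (j a').2 then Matrix.single (j a).1 (j a').1 1 else 0 := by
  ext b b'
  have h : ∀ z, (∑ x', (∑ x, if j x = (b, z) then Matrix.single a a' (1 : ℂ) x x' else 0) *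
      if j x' = (b', z) then (1 : ℂ) else 0) =
      if (j a).2 = z then (if (j a).1 = b ∧ (j a').1 = b' ∧ (j a).2 = (j a').2 then 1 else 0)
      else 0 := by
    intro z
    rw [Finset.sum_eq_single a', Finset.sum_eq_single a]
    · simp only [Matrix.single_apply_same, Prod.ext_iff, mul_ite, mul_one, mul_zero, ← ite_and]
      exact if_congr (by constructor <;> rintro ⟨⟨_, _⟩, _⟩ <;> simp_all) rfl rfl
    · intro x _ hx
      simp [hx.symm]
    · simp
    · intro x _ hx
      simp [hx.symm]
    · simp
  rw [embeddingChannel_apply, Finset.sum_congr rfl fun z _ => h z, Finset.sum_ite_eq,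
    if_pos (Finset.mem_univ _)]
  by_cases h1 : (j a).2 = (j a').2 <;> simp [h1, Matrix.single_apply]

end Channels

/-! ### The partial trace as a relabelling channel -/

section PartialTrace

variable {N : Type*} [Fintype N] [DecidableEq N] {κ : N → Type*} [∀ i, Fintype (κ i)]

theorem partialTrace_eq_embeddingChannel [∀ i, DecidableEq (κ i)] (X : Finset N) :
    partialTrace (κ := κ) X =
      embeddingChannel (Equiv.piEquivPiSubtypeProd (· ∈ X) κ) := by
  refine LinearMap.ext fun ρ => ?_
  ext a b
  simp only [embeddingChannel_apply, ← Equiv.eq_symm_apply]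
  simp [partialTrace]

theorem isQuantumOperation_partialTrace (X : Finset N) :
    IsQuantumOperation (partialTrace (κ := κ) X) := by
  classical
  rw [partialTrace_eq_embeddingChannel]
  exact isQuantumOperation_embeddingChannel (Equiv.injective _)

theorem partialTrace_single [∀ i, DecidableEq (κ i)] (X : Finset N) (y y' : ∀ i, κ i) :
    partialTrace X (Matrix.single y y' 1) =
      if (∀ i ∉ X, y i = y' i) then
        Matrix.single (fun i : {i // i ∈ X} => y i) (fun i : {i // i ∈ X} => y' i) 1 else 0 := by
  rw [partialTrace_eq_embeddingChannel, embeddingChannel_single]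
  simp [funext_iff, Equiv.piEquivPiSubtypeProd]

end PartialTrace

/-! ### A dimension bound for recoverable states, without entropy -/

section Bound

theorem map_vecMulVec_eq_of_eqOn_densityOperators {ι E : Type*} [Fintype ι] [AddCommGroup E]
    [Module ℂ E] {f g : Matrix ι ι ℂ →ₗ[ℂ] E} (h : ∀ ρ ∈ densityOperators ι, f ρ = g ρ)
    (v : ι → ℂ) : f (Matrix.vecMulVec v (star v)) = g (Matrix.vecMulVec v (star v)) := by
  by_cases hv : v = 0
  · simp [hv]
  have h0 : star v ⬝ᵥ v ≠ 0 := by simpa using hv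
  have hpos : 0 ≤ (star v ⬝ᵥ v)⁻¹ := inv_nonneg.2 (dotProduct_star_self_nonneg v)
  have hd := h ((star v ⬝ᵥ v)⁻¹ • Matrix.vecMulVec v (star v))
    ⟨(Matrix.posSemidef_vecMulVec_self_star v).smul hpos, by
      rw [Matrix.trace_smul, Matrix.trace_vecMulVec, dotProduct_comm v, smul_eq_mul,
        inv_mul_cancel₀ h0]⟩
  rw [map_smul, map_smul] at hd
  exact smul_right_injective E (inv_ne_zero h0) hd

/-- The density operators span the space of all operators. -/
theorem linearMap_ext_densityOperators {ι E : Type*} [Fintype ι] [AddCommGroup E]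
    [Module ℂ E] {f g : Matrix ι ι ℂ →ₗ[ℂ] E} (h : ∀ ρ ∈ densityOperators ι, f ρ = g ρ) :
    f = g := by
  classical
  have hv := map_vecMulVec_eq_of_eqOn_densityOperators h
  -- Polarization reduces `|u⟩⟨w|` to multiples of pure states.
  have key : ∀ u w : ι → ℂ, Matrix.vecMulVec u (star w) = (4 : ℂ)⁻¹ •
      (Matrix.vecMulVec (u + w) (star (u + w)) - Matrix.vecMulVec (u - w) (star (u - w))
        + Complex.I • Matrix.vecMulVec (u + Complex.I • w) (star (u + Complex.I • w))
        - Complex.I • Matrix.vecMulVec (u - Complex.I • w) (star (u - Complex.I • w))) := by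
    intro u w
    ext i j
    simp [Matrix.vecMulVec_apply]
    linear_combination (u i * (starRingEnd ℂ) (w j) / 2 - w i * (starRingEnd ℂ) (u j) / 2) *
      Complex.I_sq
  refine Matrix.ext_linearMap ℂ fun i j => LinearMap.ext_ring ?_
  have hs : Matrix.single i j (1 : ℂ) =
      Matrix.vecMulVec (Pi.single i 1) (star (Pi.single j 1 : ι → ℂ)) := by
    ext a b
    by_cases ha : i = a <;> by_cases hb : j = b <;>
      simp [Matrix.vecMulVec_apply, ha, hb, eq_comm]
  change f (Matrix.single i j 1) = g (Matrix.single i j 1)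
  rw [hs, key]
  simp only [map_smul, map_sub, map_add, hv]

/-- `M ≤ d · (Tr_τ M) ⊗ 1` for a positive semidefinite `M`, where `d` is the dimension of the
second factor. -/
theorem posSemidef_card_mul_trace_sub {β τ : Type*} [Fintype β] [Fintype τ] [DecidableEq τ]
    {M : Matrix (β × τ) (β × τ) ℂ} (hM : M.PosSemidef) :
    (Matrix.of fun p q : β × τ => (Fintype.card τ : ℂ) *
      (if p.2 = q.2 then ∑ t, M (p.1, t) (q.1, t) else 0) - M p q).PosSemidef := by
  classical
  let S : τ → τ → Matrix (β × τ) (β × τ) ℂ := fun t t' =>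
    Matrix.of fun p q => if p.2 = t ∧ q = (p.1, t') then 1 else 0
  have hS : ∀ t t' u u' p q, (S t t' * M * (S u u')ᴴ) p q =
      if p.2 = t ∧ q.2 = u then M (p.1, t') (q.1, u') else 0 := by
    intro t t' u u' p q
    by_cases h1 : p.2 = t <;> by_cases h2 : q.2 = u <;>
      simp [S, Matrix.mul_apply, h1, h2, apply_ite (starRingEnd ℂ)]
  -- With `S t t' = 1 ⊗ |t⟩⟨t'|`, the first sum is the pinching defect `d ∑ S t t M S t t - M`; the
  -- second supplies the terms with `t ≠ t'` that complete the pinched matrix to `d · Tr_τ M ⊗ 1`.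
  have key : (Matrix.of fun p q : β × τ => (Fintype.card τ : ℂ) *
      (if p.2 = q.2 then ∑ t, M (p.1, t) (q.1, t) else 0) - M p q) =
      (1 / 2 : ℂ) • ∑ t, ∑ t', (S t t - S t' t') * M * (S t t - S t' t')ᴴ +
      (Fintype.card τ : ℂ) • ∑ t, ∑ t', (if t = t' then 0 else 1 : ℂ) •
        (S t t' * M * (S t t')ᴴ) := by
    ext p q
    obtain ⟨b, t⟩ := p
    obtain ⟨b', t'⟩ := q
    simp only [Matrix.add_apply, Matrix.smul_apply, Matrix.sum_apply, Matrix.sub_mul,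
      Matrix.mul_sub, Matrix.conjTranspose_sub, Matrix.sub_apply, hS, Matrix.of_apply, smul_eq_mul,
      Finset.sum_sub_distrib, ite_and]
    by_cases htt : t = t'
    · subst htt
      simp [Finset.sum_ite_eq, Finset.sum_ite_irrel, Finset.sum_const, ite_mul, Finset.sum_ite,
        Finset.filter_ne, Finset.sum_erase_eq_sub]
      ring
    · simp [htt, Ne.symm htt, Finset.sum_ite_eq, Finset.sum_ite_irrel]
      ring
  rw [key]
  refine .add (.smul (Matrix.posSemidef_sum _ fun t _ => Matrix.posSemidef_sum _ fun t' _ =>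
    hM.mul_mul_conjTranspose_same _) ?_) (.smul (Matrix.posSemidef_sum _ fun t _ =>
    Matrix.posSemidef_sum _ fun t' _ => .smul (hM.mul_mul_conjTranspose_same _) ?_)
    (Nat.cast_nonneg _))
  · rw [show (1 / 2 : ℂ) = ((1 / 2 : ℝ) : ℂ) by norm_num, Complex.zero_le_real]
    norm_num
  split_ifs <;> simp

/-- If a system `α ⊗ τ` holds a quantum state that can be recovered from it, while `α` alone
carries no information on the state, then the dimension of `τ` is at least that of the state. -/
theorem card_le_card_of_recoverable {σ κ α τ : Type*} [Fintype σ] [Fintype κ] [Fintype α]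
    [Fintype τ] {Φ : Matrix σ σ ℂ →ₗ[ℂ] Matrix κ κ ℂ} {R : Matrix κ κ ℂ →ₗ[ℂ] Matrix σ σ ℂ}
    (hΦ : IsQuantumOperation Φ) (hR : IsQuantumOperation R) (hRΦ : ∀ ρ, R (Φ ρ) = ρ)
    (e : κ ≃ α × τ) {ρ₀ : Matrix α α ℂ} (hρ₀ : ρ₀.trace = 1)
    (hvan : ∀ ρ a b, ∑ t, Φ ρ (e.symm (a, t)) (e.symm (b, t)) = ρ.trace * ρ₀ a b) :
    Fintype.card σ ≤ Fintype.card τ := by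
  classical
  let f := (Fintype.equivFin σ).symm
  -- The unnormalized maximally entangled vector; its image under `id ⊗ Φ` is the Choi matrix in
  -- `hJ`.
  let w : Fin (Fintype.card σ) × σ → ℂ := fun p => if f p.1 = p.2 then 1 else 0
  let Z : Matrix κ κ ℂ := Matrix.of fun y y' =>
    if (e y).2 = (e y').2 then ρ₀ (e y).1 (e y').1 else 0
  have hZ : Z.trace = Fintype.card τ := by
    rw [Matrix.trace, ← e.symm.sum_comp, Fintype.sum_prod_type_right]
    simp only [Matrix.diag_apply, Z, Matrix.of_apply, Equiv.apply_symm_apply, if_true]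
    have : ∑ a, ρ₀ a a = 1 := hρ₀
    simp [this]
  have hJ : (Matrix.of fun p q : Fin (Fintype.card σ) × κ =>
      Φ (Matrix.single (f p.1) (f q.1) 1) p.2 q.2).PosSemidef := by
    convert hΦ.completelyPositive _ _ (Matrix.posSemidef_vecMulVec_self_star w) using 1
    ext p q
    simp only [ampliation, Matrix.of_apply]
    refine congrFun (congrFun (congrArg Φ ?_) _) _
    ext a b
    by_cases h1 : f p.1 = a <;> by_cases h2 : f q.1 = b <;>
      simp [w, Matrix.vecMulVec_apply, h1, h2]
  -- As `α` alone carries no information, the trace of the Choi matrix over `τ` is `1 ⊗ ρ₀`, so the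
  -- Choi matrix is at most `d · 1 ⊗ Z` with `Z = ρ₀ ⊗ 1`.
  have hG := (posSemidef_card_mul_trace_sub (hJ.submatrix
    fun p : (Fin (Fintype.card σ) × α) × τ => (p.1.1, e.symm (p.1.2, p.2)))).submatrix
      fun p : Fin (Fintype.card σ) × κ => ((p.1, (e p.2).1), (e p.2).2)
  -- Recovery turns this into `|w⟩⟨w| ≤ d · 1 ⊗ R Z`, restricted here to the support of `w`.
  -- Evaluation at `w` then gives `(card σ)² ≤ d · tr (R Z) = d²`.
  have hG' := (hR.completelyPositive _ _ hG).submatrix fun i => (i, f i)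
  have hQ : (Matrix.of fun i j : Fin (Fintype.card σ) =>
      (Fintype.card τ : ℂ) * (if i = j then R Z (f i) (f j) else 0) - 1).PosSemidef := by
    convert hG' using 1
    ext i j
    simp only [ampliation, Matrix.of_apply, Matrix.submatrix_apply, hvan]
    have hblock : (Matrix.of fun y y' : κ => (Fintype.card τ : ℂ) *
        (if (e y).2 = (e y').2 then
          (Matrix.single (f i) (f j) (1 : ℂ)).trace * ρ₀ (e y).1 (e y').1 else 0) -
        Φ (Matrix.single (f i) (f j) 1) (e.symm ((e y).1, (e y).2))
          (e.symm ((e y').1, (e y').2))) =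
        ((Fintype.card τ : ℂ) * (if i = j then 1 else 0)) • Z - Φ (Matrix.single (f i) (f j) 1) := by
      ext y y'
      by_cases hij : i = j
      · subst hij; simp [Z]
      · simp [hij, Matrix.trace_single_eq_of_ne, f]
    rw [hblock, map_sub, map_smul, hRΦ]
    by_cases hij : i = j
    · subst hij; simp
    · simp [hij]
  have hfin := hQ.dotProduct_mulVec_nonneg (fun _ => 1)
  have hval : star (fun _ : Fin (Fintype.card σ) => (1 : ℂ)) ⬝ᵥ ((Matrix.of fun i j =>
      (Fintype.card τ : ℂ) * (if i = j then R Z (f i) (f j) else 0) - 1) *ᵥ fun _ => 1) =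
      (((Fintype.card τ : ℝ) ^ 2 - (Fintype.card σ : ℝ) ^ 2 : ℝ) : ℂ) := by
    have ht : ∑ i, R Z (f i) (f i) = Fintype.card τ := by
      rw [f.sum_comp fun s => R Z s s]
      exact (hR.tracePreserving Z).trans hZ
    simp [dotProduct, Matrix.mulVec, Finset.sum_sub_distrib, ← Finset.mul_sum, ht]
    ring
  rw [hval, Complex.zero_le_real, sub_nonneg] at hfin
  exact_mod_cast (pow_le_pow_iff_left₀ (by positivity) (by positivity) two_ne_zero).1 hfin

end Bound

/-! ### Forbidden inside qualified, and the optimality bound -/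

section Optimality

variable {N : Type*} [DecidableEq N] {κ : N → Type*}

/-- The shares in `X` consist of those in `A` and those in `X \ A`. -/
def sharesEquiv {A X : Finset N} (h : A ⊆ X) : (∀ i : {i // i ∈ X}, κ i) ≃
    (∀ i : {i // i ∈ A}, κ i) × (∀ i : {i // i ∈ X \ A}, κ i) where
  toFun f := (fun i => f ⟨i, h i.2⟩, fun i => f ⟨i, (Finset.mem_sdiff.1 i.2).1⟩)
  invFun p i := if hi : i.1 ∈ A then p.1 ⟨i, hi⟩ else p.2 ⟨i, Finset.mem_sdiff.2 ⟨i.2, hi⟩⟩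
  left_inv f := by ext i; simp
  right_inv p := by
    ext i
    · simp
    · simp [(Finset.mem_sdiff.1 i.2).2]

/-- The shares outside `A` consist of those in `X \ A` and those outside `X`. -/
def complementEquiv {A X : Finset N} (h : A ⊆ X) :
    (∀ i : {i // i ∈ X \ A}, κ i) × (∀ i : {i // i ∉ X}, κ i) ≃ (∀ i : {i // i ∉ A}, κ i) where
  toFun p i := if hi : i.1 ∈ X then p.1 ⟨i, Finset.mem_sdiff.2 ⟨hi, i.2⟩⟩ else p.2 ⟨i, hi⟩
  invFun f := (fun i => f ⟨i, (Finset.mem_sdiff.1 i.2).2⟩, fun i => f ⟨i, fun hi => i.2 (h hi)⟩)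
  left_inv p := by
    ext i
    · simp [(Finset.mem_sdiff.1 i.2).1]
    · simp [i.2]
  right_inv f := by ext i; by_cases hi : i.1 ∈ X <;> simp [hi]

variable [Fintype N] [∀ i, Fintype (κ i)]

theorem sum_partialTrace_sharesEquiv {A X : Finset N} (h : A ⊆ X)
    (ρ : Matrix (∀ i, κ i) (∀ i, κ i) ℂ) (a b : ∀ i : {i // i ∈ A}, κ i) :
    ∑ t, partialTrace X ρ ((sharesEquiv h).symm (a, t)) ((sharesEquiv h).symm (b, t)) =
      partialTrace A ρ a b := by
  have hc : ∀ (a : ∀ i : {i // i ∈ A}, κ i) t z,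
      (Equiv.piEquivPiSubtypeProd (· ∈ X) κ).symm ((sharesEquiv h).symm (a, t), z) =
        (Equiv.piEquivPiSubtypeProd (· ∈ A) κ).symm (a, complementEquiv h (t, z)) := by
    intro a t z
    ext i
    by_cases hA : i ∈ A
    · simp [Equiv.piEquivPiSubtypeProd, sharesEquiv, hA, h hA]
    · by_cases hX : i ∈ X <;>
        simp [Equiv.piEquivPiSubtypeProd, sharesEquiv, complementEquiv, hA, hX]
  simp only [partialTrace, LinearMap.coe_mk, AddHom.coe_mk, Matrix.of_apply, hc]
  rw [← Fintype.sum_prod_type', ← (complementEquiv h).sum_comp]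

/-- If `A ⊆ X`, where `A` is forbidden and `X` is qualified, then the dimension of the secret is at
most the dimension of the shares in `X \ A`. -/
theorem card_le_prod_card_of_isForbidden_of_isQualified {σ : Type*} [Fintype σ]
    {W : Matrix σ σ ℂ →ₗ[ℂ] Matrix (∀ i, κ i) (∀ i, κ i) ℂ} (hW : IsQuantumOperation W)
    {A X : Finset N} (hAX : A ⊆ X) (hA : IsForbidden W A) (hX : IsQualified W X) :
    Fintype.card σ ≤ ∏ i ∈ X \ A, Fintype.card (κ i) := by
  classical
  obtain ⟨ρ₀, hρ₀, hvan⟩ := hA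
  obtain ⟨R, hR, hrec⟩ := hX
  -- Both hypotheses are extended from density operators to all matrices, because the Choi matrix
  -- involves off-diagonal matrix units.
  have hrec' : R ∘ₗ (partialTrace X ∘ₗ W) = LinearMap.id :=
    linearMap_ext_densityOperators hrec
  have hvan' : partialTrace A ∘ₗ W = (Matrix.traceLinearMap σ ℂ ℂ).smulRight ρ₀ :=
    linearMap_ext_densityOperators fun ρ hρ => by
      rw [hvan ρ hρ, LinearMap.smulRight_apply, Matrix.traceLinearMap_apply, hρ.2, one_smul]
  have hle := card_le_card_of_recoverable ((isQuantumOperation_partialTrace X).comp hW) hR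
    (LinearMap.congr_fun hrec') (sharesEquiv hAX) hρ₀.2 fun ρ a b => by
      have := congrFun (congrFun (LinearMap.congr_fun hvan' ρ) a) b
      simpa [sum_partialTrace_sharesEquiv] using this
  rw [Fintype.card_pi, Finset.prod_coe_sort (X \ A) fun i => Fintype.card (κ i)] at hle
  exact hle

theorem hilbertDim_eq_card (ι : Type*) [Fintype ι] : hilbertDim ι = Fintype.card ι :=
  finrank_euclideanSpace

theorem sum_cyclic_shifts {n L : ℕ} [NeZero n] (h : L ≤ n) (a : Fin n → ℝ) :
    ∑ j, ∑ l : Fin L, a (Fin.castLE h l + j) = L * ∑ i, a i := by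
  have hl : ∀ l : Fin L, ∑ j, a (Fin.castLE h l + j) = ∑ i, a i := fun l =>
    Equiv.sum_comp (Equiv.addLeft (Fin.castLE h l)) a
  rw [Finset.sum_comm]
  simp [hl]

theorem IsThresholdRampScheme.log_hilbertDim_le {k L n : ℕ} (hL : 1 ≤ L) (hLk : L ≤ k)
    (hn : n + L = 2 * k) {σ : Type*} {κ : Fin n → Type*} [Fintype σ] [∀ i, Fintype (κ i)]
    {W : Matrix σ σ ℂ →ₗ[ℂ] Matrix (∀ i, κ i) (∀ i, κ i) ℂ} (hW : IsThresholdRampScheme k L W) :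
    1 / (L : ℝ) * Real.log (hilbertDim σ) ≤
      1 / (n : ℝ) * ∑ i, Real.log (hilbertDim (κ i)) := by
  simp only [hilbertDim_eq_card]
  have hn0 : 0 < n := by omega
  have hLn : L ≤ n := by omega
  have : NeZero n := ⟨hn0.ne'⟩
  have hset : ∀ T : Finset (Fin n), T.card = L →
      Real.log (Fintype.card σ) ≤ ∑ i ∈ T, Real.log (Fintype.card (κ i)) := by
    intro T hT
    -- For a zero secret space the convention `Real.log 0 = 0` makes the claim trivial.
    rcases (Fintype.card σ).eq_zero_or_pos with h0 | h0
    · rw [h0]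
      simpa using Finset.sum_nonneg fun i _ => Real.log_natCast_nonneg (Fintype.card (κ i))
    -- There is room for `A` since `n - L = 2 (k - L)`; then `A` is forbidden and `T ∪ A`, of size
    -- `k`, is qualified.
    obtain ⟨A, hAT, hA⟩ := Finset.exists_subset_card_eq (s := Tᶜ) (n := k - L) (by
      rw [Finset.card_compl, Fintype.card_fin]; omega)
    have hd : Disjoint T A := (Finset.subset_compl_iff_disjoint_left.1 hAT)
    have hle := card_le_prod_card_of_isForbidden_of_isQualified hW.isQSSScheme.1
      (Finset.subset_union_right (s₁ := T) (s₂ := A))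
      ((hW.forbidden_iff A).2 (by omega)) ((hW.qualified_iff (T ∪ A)).2 (by
        rw [Finset.card_union_of_disjoint hd]; omega))
    rw [Finset.union_sdiff_cancel_right hd] at hle
    have hne : ∀ i ∈ T, (Fintype.card (κ i) : ℝ) ≠ 0 := by
      intro i hi h
      rw [Finset.prod_eq_zero hi (by exact_mod_cast h)] at hle
      omega
    rw [← Real.log_prod hne]
    exact Real.log_le_log (by exact_mod_cast h0) (by exact_mod_cast hle)
  have hshift : ∀ j : Fin n, Real.log (Fintype.card σ) ≤
      ∑ l : Fin L, Real.log (Fintype.card (κ (Fin.castLE hLn l + j))) := by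
    intro j
    have hinj : Function.Injective fun l : Fin L => Fin.castLE hLn l + j :=
      (add_left_injective j).comp (Fin.castLE_injective hLn)
    have := hset (Finset.univ.map ⟨_, hinj⟩) (by simp)
    simpa using this
  have htot := Finset.sum_le_sum fun j (_ : j ∈ Finset.univ) => hshift j
  rw [sum_cyclic_shifts hLn fun i => Real.log (Fintype.card (κ i))] at htot
  simp only [Finset.sum_const, Finset.card_univ, Fintype.card_fin, nsmul_eq_mul] at htot
  have hn' : (0 : ℝ) < n := by exact_mod_cast hn0
  have hL' : (0 : ℝ) < L := by exact_mod_cast hL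
  rw [one_div_mul_eq_div, one_div_mul_eq_div, div_le_div_iff₀ hL' hn']
  linarith

end Optimality

/-! ### Uniform superpositions of codewords -/

section Superposition

variable {C σ N : Type*} [Fintype C] [Fintype σ] [DecidableEq σ] [Fintype N] [DecidableEq N]
  {κ : N → Type*} [∀ i, Fintype (κ i)]

theorem isPureStateScheme_conjugation {V : Matrix (∀ i, κ i) σ ℂ} (hV : Vᴴ * V = 1)
    (hQ : IsQualified (conjugation V) Finset.univ) : IsPureStateScheme (conjugation V) := by
  obtain ⟨R, hR, hrec⟩ := hQ
  refine ⟨⟨isQuantumOperation_conjugation hV, R ∘ₗ partialTrace Finset.univ,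
    hR.comp (isQuantumOperation_partialTrace _), hrec⟩, ?_⟩
  rintro _ ⟨v, hv, rfl⟩
  refine ⟨V *ᵥ v, ?_, ?_⟩
  · rw [Matrix.star_mulVec, ← Matrix.dotProduct_mulVec, Matrix.mulVec_mulVec, hV,
      Matrix.one_mulVec, hv]
  · rw [Matrix.star_mulVec, conjugation, LinearMap.coe_mk, AddHom.coe_mk, Matrix.mul_vecMulVec,
      Matrix.vecMulVec_mul]

variable [∀ i, DecidableEq (κ i)]

/-- The linear map that sends `|s⟩` to `r ∑_c |E c⟩`, where `c` runs through the fibre of `π`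
over `s`. -/
def superposition (r : ℝ) (E : C → ∀ i, κ i) (π : C → σ) : Matrix (∀ i, κ i) σ ℂ :=
  (r : ℂ) • ∑ c, Matrix.single (E c) (π c) 1

variable {r : ℝ} {E : C → ∀ i, κ i} {π : C → σ} {X : Finset N}

theorem partialTrace_conjugation_superposition (ρ : Matrix σ σ ℂ) :
    partialTrace X (conjugation (superposition r E π) ρ) =
      ((r : ℂ) ^ 2) • ∑ c, ∑ c', ρ (π c) (π c') •
        if ∀ i ∉ X, E c i = E c' i then
          Matrix.single (fun i : {i // i ∈ X} => E c i) (fun i : {i // i ∈ X} => E c' i) 1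
        else 0 := by
  have h : conjugation (superposition r E π) ρ =
      ((r : ℂ) ^ 2) • ∑ c, ∑ c', ρ (π c) (π c') • Matrix.single (E c) (E c') 1 := by
    simp only [conjugation, superposition, LinearMap.coe_mk, AddHom.coe_mk,
      Matrix.conjTranspose_smul, Matrix.conjTranspose_sum, Matrix.conjTranspose_single,
      Matrix.smul_mul, Matrix.mul_smul, ← Finset.smul_sum, smul_smul, Matrix.sum_mul, Matrix.mul_sum,
      Matrix.single_mul_mul_single, Matrix.smul_single, Complex.star_def, Complex.conj_ofReal,
      star_one, one_mul, mul_one, smul_eq_mul, sq]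
    rw [Finset.sum_comm]
  simp only [h, map_smul, map_sum, partialTrace_single]

/-- The codewords are orthonormal, and `g` identifies each fibre of `π` with `τ`, so `r` normalizes
every encoded vector. -/
theorem superposition_isometry {τ : Type*} [Fintype τ] {g : C → τ}
    (hg : Function.Bijective fun c => (π c, g c)) (hE : Function.Injective E)
    (hr : r ^ 2 * Fintype.card τ = 1) : (superposition r E π)ᴴ * superposition r E π = 1 := by
  classical
  have hr' : (r : ℂ) ^ 2 * Fintype.card τ = 1 := by exact_mod_cast hr
  have h : ∀ c c', Matrix.single (π c) (E c) (1 : ℂ) * Matrix.single (E c') (π c') (1 : ℂ) =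
      if c = c' then Matrix.single (π c) (π c) 1 else 0 := by
    intro c c'
    split_ifs with hc
    · subst hc; simp
    · exact Matrix.single_mul_single_of_ne _ _ _ _ (hE.ne hc) _
  simp only [superposition, Matrix.conjTranspose_smul, Matrix.conjTranspose_sum,
    Matrix.conjTranspose_single, Matrix.smul_mul, Matrix.mul_smul, ← Finset.smul_sum, smul_smul, Matrix.sum_mul,
    Matrix.mul_sum, Complex.star_def, Complex.conj_ofReal, star_one, h,
    Finset.sum_ite_eq', Finset.mem_univ, if_true]
  have hsum : ∑ c, Matrix.single (π c) (π c) (1 : ℂ) =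
      ∑ p : σ × τ, Matrix.single p.1 p.1 (1 : ℂ) :=
    (Equiv.ofBijective _ hg).sum_comp fun p : σ × τ => Matrix.single p.1 p.1 (1 : ℂ)
  rw [hsum, Fintype.sum_prod_type_right]
  simp only [Finset.sum_const, Finset.card_univ, ← Nat.cast_smul_eq_nsmul ℂ, smul_smul]
  rw [← sq, hr', one_smul, Matrix.sum_single_one]

theorem isQualified_superposition [Nonempty σ] {τ : Type*} [Fintype τ] {g : C → τ}
    (hg : Function.Bijective fun c => (π c, g c))
    (hgE : ∀ c c', g c = g c' → ∀ i ∉ X, E c i = E c' i)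
    (hE : Function.Injective fun c (i : {i // i ∈ X}) => E c i)
    (hr : r ^ 2 * Fintype.card τ = 1) :
    IsQualified (conjugation (superposition r E π)) X := by
  classical
  have hr' : (r : ℂ) ^ 2 * Fintype.card τ = 1 := by exact_mod_cast hr
  obtain ⟨s₀⟩ := ‹Nonempty σ›
  -- A codeword restricted to `X` is decoded to its secret and its label `g c`. Other basis states
  -- go to a separate summand, which keeps `j` injective and the recovery trace preserving.
  let j : (∀ i : {i // i ∈ X}, κ i) → σ × (τ ⊕ (∀ i : {i // i ∈ X}, κ i)) :=
    Function.extend (fun c (i : {i // i ∈ X}) => E c i) (fun c => (π c, Sum.inl (g c)))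
      fun a => (s₀, Sum.inr a)
  have hj : ∀ c, j (fun i => E c i) = (π c, Sum.inl (g c)) := fun c => hE.extend_apply _ _ c
  have hj' : ∀ a, (¬ ∃ c, (fun i : {i // i ∈ X} => E c i) = a) → j a = (s₀, Sum.inr a) :=
    fun a ha => Function.extend_apply' _ _ a ha
  have hinj : Function.Injective j := by
    intro a b hab
    by_cases ha : ∃ c, (fun i : {i // i ∈ X} => E c i) = a <;>
      by_cases hb : ∃ c, (fun i : {i // i ∈ X} => E c i) = b
    · obtain ⟨c, rfl⟩ := ha
      obtain ⟨c', rfl⟩ := hb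
      rw [hj, hj] at hab
      have : c = c' := hg.1 (by simpa using hab)
      rw [this]
    · obtain ⟨c, rfl⟩ := ha
      rw [hj, hj' _ hb] at hab
      simp at hab
    · obtain ⟨c, rfl⟩ := hb
      rw [hj, hj' _ ha] at hab
      simp at hab
    · rw [hj' _ ha, hj' _ hb] at hab
      simpa using hab
  refine ⟨embeddingChannel j, isQuantumOperation_embeddingChannel hinj, fun ρ _ => ?_⟩
  -- Agreement outside `X` is implied by `g c = g c'`, and discarding the label removes the pairs
  -- with `g c ≠ g c'`; only the condition on `g` survives.
  have h : ∀ c c', embeddingChannel j (if ∀ i ∉ X, E c i = E c' i then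
      Matrix.single (fun i : {i // i ∈ X} => E c i) (fun i : {i // i ∈ X} => E c' i) 1 else 0) =
      if g c = g c' then Matrix.single (π c) (π c') (1 : ℂ) else 0 := by
    intro c c'
    by_cases hc : g c = g c'
    · rw [if_pos (hgE c c' hc), embeddingChannel_single]
      simp [hj, hc]
    · split_ifs
      · rw [embeddingChannel_single]
        simp [hj, hc]
      · simp
  let e := Equiv.ofBijective _ hg
  have hsum : ∑ c, ∑ c', (ρ (π c) (π c') •
      if g c = g c' then Matrix.single (π c) (π c') (1 : ℂ) else 0) =
      ∑ p : σ × τ, ∑ p' : σ × τ, (ρ p.1 p'.1 •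
        if p.2 = p'.2 then Matrix.single p.1 p'.1 (1 : ℂ) else 0) := by
    rw [← e.sum_comp]
    exact Finset.sum_congr rfl fun c _ => by rw [← e.sum_comp]; rfl
  rw [LinearMap.comp_apply, partialTrace_conjugation_superposition]
  simp only [map_smul, map_sum, h]
  rw [hsum]
  simp only [Fintype.sum_prod_type, smul_ite, smul_zero, Finset.sum_ite_eq, Finset.mem_univ,
    if_true, Matrix.smul_single, smul_eq_mul, mul_one]
  simp only [Finset.sum_comm (s := (Finset.univ : Finset τ)), Finset.sum_const, Finset.card_univ, ← Nat.cast_smul_eq_nsmul ℂ, ← Finset.smul_sum,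
    smul_smul]
  rw [hr', one_smul]
  exact (Matrix.matrix_eq_sum_single ρ).symm

theorem isForbidden_superposition [Nonempty σ]
    (hW : IsQuantumOperation (conjugation (superposition r E π)))
    (hE : ∀ c c', (∀ i ∉ X, E c i = E c' i) → c = c') {K : ℕ}
    (hK : ∀ p : σ × (∀ i : {i // i ∈ X}, κ i),
      (Finset.univ.filter fun c => (π c, fun i : {i // i ∈ X} => E c i) = p).card = K) :
    IsForbidden (conjugation (superposition r E π)) X := by
  classical
  have key : ∀ ρ, partialTrace X (conjugation (superposition r E π) ρ) =
      ((r : ℂ) ^ 2 * K * ρ.trace) • 1 := by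
    intro ρ
    have h : ∀ c c', (ρ (π c) (π c') • if ∀ i ∉ X, E c i = E c' i then
        Matrix.single (fun i : {i // i ∈ X} => E c i) (fun i : {i // i ∈ X} => E c' i) (1 : ℂ)
        else 0) = if c = c' then ρ (π c) (π c) •
        Matrix.single (fun i : {i // i ∈ X} => E c i) (fun i : {i // i ∈ X} => E c i) (1 : ℂ)
        else 0 := by
      intro c c'
      by_cases hc : c = c'
      · subst hc; simp
      · rw [if_neg fun h => hc (hE c c' h), if_neg hc, smul_zero]
    have hsum : ∑ c, ρ (π c) (π c) •
        Matrix.single (fun i : {i // i ∈ X} => E c i) (fun i : {i // i ∈ X} => E c i) (1 : ℂ) =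
        ∑ p : σ × (∀ i : {i // i ∈ X}, κ i), K • (ρ p.1 p.1 • Matrix.single p.2 p.2 (1 : ℂ)) := by
      rw [← Finset.sum_fiberwise Finset.univ fun c => (π c, fun i : {i // i ∈ X} => E c i)]
      refine Finset.sum_congr rfl fun p _ => ?_
      rw [← hK p, ← Finset.sum_const]
      refine Finset.sum_congr rfl fun c hc => ?_
      rw [← (Finset.mem_filter.1 hc).2]
    rw [partialTrace_conjugation_superposition]
    simp only [h, Finset.sum_ite_eq, Finset.mem_univ, if_true]
    rw [hsum, Fintype.sum_prod_type]
    simp only [← Nat.cast_smul_eq_nsmul ℂ, ← Finset.smul_sum, Matrix.sum_single_one,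
      ← Finset.sum_smul, smul_smul, ← Finset.mul_sum, mul_assoc]
    rfl
  obtain ⟨s⟩ := ‹Nonempty σ›
  refine ⟨((r : ℂ) ^ 2 * K) • 1, ⟨Matrix.PosSemidef.one.smul ?_, ?_⟩, fun ρ hρ => ?_⟩
  · have : (0 : ℝ) ≤ r ^ 2 * K := by positivity
    exact_mod_cast this
  -- Trace preservation normalizes the state, so `K` need not be computed.
  · have h := ((isQuantumOperation_partialTrace X).comp hW).tracePreserving (Matrix.single s s 1)
    rw [LinearMap.comp_apply, key, Matrix.trace_single_eq_same, mul_one] at h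
    exact h
  · rw [LinearMap.comp_apply, key, hρ.2, mul_one]

end Superposition

/-! ### Polynomial interpolation and the threshold scheme -/

section ReedSolomon

variable {F : Type*} [Field F] {k L n : ℕ}

theorem polyEval_eq_eval_ofFn [DecidableEq F] (c : Fin k → F) (t : F) :
    polyEval c t = (Polynomial.ofFn k c).eval t := by
  rcases k.eq_zero_or_pos with rfl | hk
  · simp [polyEval]
  rw [Polynomial.eval_eq_sum_range' (Polynomial.ofFn_natDegree_lt hk c),
    ← Fin.sum_univ_eq_sum_range fun i => (Polynomial.ofFn k c).coeff i * t ^ i, polyEval]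
  exact Finset.sum_congr rfl fun i _ => by rw [Polynomial.ofFn_coeff_eq_val_of_lt _ i.2]

theorem polyEval_coeff {P : Polynomial F} (hP : P.degree < (k : WithBot ℕ)) (t : F) :
    polyEval (fun i : Fin k => P.coeff i) t = P.eval t := by
  by_cases h0 : P = 0
  · simp [polyEval, h0]
  rw [Polynomial.eval_eq_sum_range' ((Polynomial.natDegree_lt_iff_degree_lt h0).2 hP),
    ← Fin.sum_univ_eq_sum_range fun i => P.coeff i * t ^ i, polyEval]

theorem polyEval_injective {x : Fin n → F} (hx : Function.Injective x) {Z : Finset (Fin n)}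
    (hZ : k ≤ Z.card) :
    Function.Injective fun (c : Fin k → F) (i : {i // i ∈ Z}) => polyEval c (x i) := by
  classical
  intro c c' h
  have hP : Polynomial.ofFn k c = Polynomial.ofFn k c' := by
    refine Polynomial.eq_of_degrees_lt_of_eval_index_eq Z hx.injOn
      ((Polynomial.ofFn_degree_lt c).trans_le (by exact_mod_cast hZ))
      ((Polynomial.ofFn_degree_lt c').trans_le (by exact_mod_cast hZ)) fun i hi => ?_
    rw [← polyEval_eq_eval_ofFn, ← polyEval_eq_eval_ofFn]
    exact congrFun h ⟨i, hi⟩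
  ext i
  rw [← Polynomial.ofFn_coeff_eq_val_of_lt c i.2, hP, Polynomial.ofFn_coeff_eq_val_of_lt c' i.2]

/-- A polynomial of degree less than `k` with prescribed low coefficients and values. -/
theorem exists_firstPositions_polyEval (hLk : L ≤ k) {x : Fin n → F} (hx : Function.Injective x)
    (hx0 : L < k → ∀ i, x i ≠ 0) {Z : Finset (Fin n)} (hZ : Z.card + L ≤ k) (s : Fin L → F)
    (a : Fin n → F) :
    ∃ c : Fin k → F, (∀ j, c (firstPositions hLk j) = s j) ∧ ∀ i ∈ Z, polyEval c (x i) = a i := by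
  classical
  let g := Lagrange.interpolate Z x
    fun i => (a i - (Polynomial.ofFn L s).eval (x i)) / x i ^ L
  have hg : g.degree < (k - L : ℕ) :=
    (Lagrange.degree_interpolate_lt _ hx.injOn).trans_le (by exact_mod_cast Nat.le_sub_of_add_le hZ)
  -- The factor `X ^ L` protects the low coefficients; its price is the division by `x i ^ L` in
  -- `g`, hence the nonzero points.
  have hP : (Polynomial.ofFn L s + Polynomial.X ^ L * g).degree < (k : WithBot ℕ) := by
    refine (Polynomial.degree_add_le _ _).trans_lt (max_lt
      ((Polynomial.ofFn_degree_lt s).trans_le (by exact_mod_cast hLk)) ?_)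
    rw [Polynomial.degree_lt_iff_coeff_zero] at hg ⊢
    intro m hm
    rw [Polynomial.coeff_X_pow_mul', if_pos (hLk.trans hm), hg _ (Nat.sub_le_sub_right hm L)]
  refine ⟨fun i => (Polynomial.ofFn L s + Polynomial.X ^ L * g).coeff i, fun j => ?_,
    fun i hi => ?_⟩
  · beta_reduce
    rw [Polynomial.coeff_add, Polynomial.coeff_X_pow_mul', if_neg (by simp [firstPositions]),
      add_zero]
    exact Polynomial.ofFn_coeff_eq_val_of_lt s j.2
  · have hLk' : L < k := by have := Finset.card_pos.2 ⟨i, hi⟩; omega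
    rw [polyEval_coeff hP, Polynomial.eval_add, Polynomial.eval_mul,
      Lagrange.eval_interpolate_at_node _ hx.injOn hi, Polynomial.eval_pow, Polynomial.eval_X,
      mul_div_cancel₀ _ (pow_ne_zero _ (hx0 hLk' i)), add_sub_cancel]

/-- A polynomial of degree less than `k` with prescribed high coefficients and values. -/
theorem exists_lastPositions_polyEval (hLk : L ≤ k) {x : Fin n → F} (hx : Function.Injective x)
    {Z : Finset (Fin n)} (hZ : Z.card + L ≤ k) (s : Fin L → F) (a : Fin n → F) :
    ∃ c : Fin k → F, (∀ j, c (lastPositions hLk j) = s j) ∧ ∀ i ∈ Z, polyEval c (x i) = a i := by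
  classical
  let g := Lagrange.interpolate Z x
    fun i => a i - x i ^ (k - L) * (Polynomial.ofFn L s).eval (x i)
  have hg : g.degree < (k - L : ℕ) :=
    (Lagrange.degree_interpolate_lt _ hx.injOn).trans_le (by exact_mod_cast Nat.le_sub_of_add_le hZ)
  -- Here the interpolant has degree below `k - L` and cannot reach the secret coefficients, so no
  -- division is needed.
  have hP : (g + Polynomial.X ^ (k - L) * Polynomial.ofFn L s).degree < (k : WithBot ℕ) := by
    refine (Polynomial.degree_add_le _ _).trans_lt (max_lt
      (hg.trans_le (by exact_mod_cast Nat.sub_le k L)) ?_)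
    rw [Polynomial.degree_lt_iff_coeff_zero]
    intro m hm
    rw [Polynomial.coeff_X_pow_mul', if_pos (by omega),
      Polynomial.ofFn_coeff_eq_zero_of_ge s (by omega)]
  refine ⟨fun i => (g + Polynomial.X ^ (k - L) * Polynomial.ofFn L s).coeff i, fun j => ?_,
    fun i hi => ?_⟩
  · have h0 : g.coeff (k - L + j) = 0 :=
      Polynomial.degree_lt_iff_coeff_zero _ _ |>.1 hg _ (Nat.le_add_right _ _)
    simp only [lastPositions, Polynomial.coeff_add, h0, zero_add]
    rw [add_comm, Polynomial.coeff_X_pow_mul]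
    exact Polynomial.ofFn_coeff_eq_val_of_lt s j.2
  · rw [polyEval_coeff hP, Polynomial.eval_add, Polynomial.eval_mul,
      Lagrange.eval_interpolate_at_node _ hx.injOn hi, Polynomial.eval_pow, Polynomial.eval_X,
      sub_add_cancel]

variable [Fintype F] [DecidableEq F]

theorem encoder_eq_superposition (pos : Fin L → Fin k) (x : Fin n → F) :
    encoder pos x = superposition (κ := fun _ => F)
      (1 / Real.sqrt ((Fintype.card F : ℝ) ^ (k - L)))
      (fun c i => polyEval c (x i)) (fun (c : Fin k → F) j => c (pos j)) := by
  ext y s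
  simp only [encoder, encodedVector, superposition, coefficientSet, Matrix.of_apply, Pi.smul_apply,
    Matrix.smul_apply, Finset.sum_apply, Matrix.sum_apply, Finset.sum_filter]
  congr 1
  refine Finset.sum_congr rfl fun c _ => ?_
  by_cases h : ∀ j, c (pos j) = s j
  · simp [Matrix.single_apply, Pi.single_apply, h, eq_comm]
  · simp [funext_iff, h]

/-- The map from coefficients to secret and values is a surjective additive homomorphism, so its
fibres are cosets of the kernel. -/
theorem card_filter_prescribed {x : Fin n → F} {pos : Fin L → Fin k} {Z : Finset (Fin n)}
    (hZ : ∀ (s : Fin L → F) (a : Fin n → F), ∃ c : Fin k → F,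
      (∀ j, c (pos j) = s j) ∧ ∀ i ∈ Z, polyEval c (x i) = a i)
    (p p' : (Fin L → F) × ({i // i ∈ Z} → F)) :
    (Finset.univ.filter fun c : Fin k → F =>
      ((fun j => c (pos j)), fun i : {i // i ∈ Z} => polyEval c (x i)) = p).card =
    (Finset.univ.filter fun c : Fin k → F =>
      ((fun j => c (pos j)), fun i : {i // i ∈ Z} => polyEval c (x i)) = p').card := by
  let φ : (Fin k → F) →+ (Fin L → F) × ({i // i ∈ Z} → F) :=
    { toFun c := (fun j => c (pos j), fun i => polyEval c (x i))
      map_zero' := by ext <;> simp [polyEval]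
      map_add' c c' := by ext <;> simp [polyEval, add_mul, Finset.sum_add_distrib] }
  have hφ : Function.Surjective φ := by
    intro p
    obtain ⟨c, hc, hc'⟩ := hZ p.1 fun i => if hi : i ∈ Z then p.2 ⟨i, hi⟩ else 0
    refine ⟨c, Prod.ext (funext hc) (funext fun i => (hc' i i.2).trans ?_)⟩
    simp
  exact AddMonoidHom.card_fiber_eq_of_mem_range φ (hφ p) (hφ p')

theorem isPureRampEncoding_encoder (hL : 1 ≤ L) (hLk : L ≤ k) (hn : n + L = 2 * k)
    {x : Fin n → F} (hx : Function.Injective x) {pos : Fin L → Fin k}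
    (hpos : ∀ Z : Finset (Fin n), Z.card + L ≤ k → ∀ (s : Fin L → F) (a : Fin n → F),
      ∃ c : Fin k → F, (∀ j, c (pos j) = s j) ∧ ∀ i ∈ Z, polyEval c (x i) = a i) :
    IsPureRampEncoding k L (encoder pos x) := by
  have hq : 1 < Fintype.card F := Fintype.one_lt_card
  have hbij : ∀ Z : Finset (Fin n), Z.card = k - L → Function.Bijective fun c : Fin k → F =>
      ((fun j => c (pos j)), fun i : {i // i ∈ Z} => polyEval c (x i)) := by
    intro Z hZ
    refine (Fintype.bijective_iff_surjective_and_card _).2 ⟨fun p => ?_, ?_⟩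
    · obtain ⟨c, hc, hc'⟩ := hpos Z (by omega) p.1 fun i => if hi : i ∈ Z then p.2 ⟨i, hi⟩ else 0
      refine ⟨c, Prod.ext (funext hc) (funext fun i => ?_)⟩
      simpa using hc' i i.2
    · rw [Fintype.card_prod, Fintype.card_fun, Fintype.card_fun, Fintype.card_fun,
        Fintype.card_coe, hZ, Fintype.card_fin, Fintype.card_fin, ← pow_add]
      congr 1
      omega
  have hr : ∀ Z : Finset (Fin n), Z.card = k - L →
      (1 / Real.sqrt ((Fintype.card F : ℝ) ^ (k - L))) ^ 2 *
        Fintype.card ({i // i ∈ Z} → F) = 1 := by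
    intro Z hZ
    rw [Fintype.card_fun, Fintype.card_coe, hZ, div_pow, one_pow, Real.sq_sqrt (by positivity)]
    push_cast
    exact one_div_mul_cancel (by positivity)
  have hqual : ∀ X : Finset (Fin n), k ≤ X.card →
      IsQualified (κ := fun _ : Fin n => F) (conjugation (encoder pos x)) X := by
    intro X hX
    obtain ⟨Z, hXZ, hZ⟩ := Finset.exists_superset_card_eq (s := Xᶜ) (n := k - L)
      (by rw [Finset.card_compl, Fintype.card_fin]; omega) (by rw [Fintype.card_fin]; omega)
    rw [encoder_eq_superposition]
    refine isQualified_superposition (hbij Z hZ) (fun c c' h i hi => ?_)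
      (polyEval_injective hx hX) (hr Z hZ)
    exact congrFun h ⟨i, hXZ (Finset.mem_compl.2 hi)⟩
  have hV : (encoder pos x)ᴴ * encoder pos x = 1 := by
    obtain ⟨Z, -, hZ⟩ := Finset.exists_superset_card_eq (s := (∅ : Finset (Fin n))) (n := k - L)
      (by simp) (by rw [Fintype.card_fin]; omega)
    rw [encoder_eq_superposition]
    refine superposition_isometry (hbij Z hZ) (fun c c' h => ?_) (hr Z hZ)
    exact polyEval_injective hx (Z := Finset.univ) (by rw [Finset.card_univ, Fintype.card_fin]; omega)
      (funext fun i => congrFun h i)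
  have hW := isQuantumOperation_conjugation hV
  have hforb : ∀ X : Finset (Fin n), X.card + L ≤ k →
      IsForbidden (κ := fun _ : Fin n => F) (conjugation (encoder pos x)) X := by
    intro X hX
    rw [encoder_eq_superposition] at hW ⊢
    refine isForbidden_superposition hW (fun c c' h => ?_)
      fun p => card_filter_prescribed (hpos X hX) p 0
    refine polyEval_injective hx (Z := Xᶜ)
      (by rw [Finset.card_compl, Fintype.card_fin]; omega) (funext fun i => ?_)
    exact h i (Finset.mem_compl.1 i.2)
  -- The secret has dimension `q ^ L` and the shares in `X \ A` have dimension `q ^ |X \ A|`.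
  have hgap : ∀ A X : Finset (Fin n), A ⊆ X →
      IsForbidden (κ := fun _ : Fin n => F) (conjugation (encoder pos x)) A →
      IsQualified (κ := fun _ : Fin n => F) (conjugation (encoder pos x)) X →
      A.card + L ≤ X.card := by
    intro A X hAX hA hX
    have h := card_le_prod_card_of_isForbidden_of_isQualified hW hAX hA hX
    rw [Finset.prod_const, Fintype.card_fun, Fintype.card_fin, Nat.pow_le_pow_iff_right hq,
      Finset.card_sdiff_of_subset hAX] at h
    have := Finset.card_le_card hAX
    omega
  have hq_iff : ∀ X : Finset (Fin n),
      IsQualified (κ := fun _ : Fin n => F) (conjugation (encoder pos x)) X ↔ k ≤ X.card := by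
    refine fun X => ⟨fun hX => ?_, hqual X⟩
    -- The largest subset already known to be forbidden. If it were all of `X`, the gap would
    -- contradict `1 ≤ L`.
    obtain ⟨A, hAX, hA⟩ := Finset.exists_subset_card_eq (min_le_left X.card (k - L))
    have := hgap A X hAX (hforb A (by omega)) hX
    omega
  have hf_iff : ∀ X : Finset (Fin n),
      IsForbidden (κ := fun _ : Fin n => F) (conjugation (encoder pos x)) X ↔ X.card + L ≤ k := by
    refine fun X => ⟨fun hX => ?_, hforb X⟩
    have hXn := Finset.card_le_univ X
    rw [Fintype.card_fin] at hXn
    obtain ⟨Y, hXY, hY⟩ := Finset.exists_superset_card_eq (le_max_left X.card k)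
      (by rw [Fintype.card_fin]; omega)
    have := hgap X Y hXY hX (hqual Y (by omega))
    omega
  have hpure := isPureStateScheme_conjugation (κ := fun _ : Fin n => F) hV
    (hqual Finset.univ (by rw [Finset.card_univ, Fintype.card_fin]; omega))
  refine ⟨hV, hpure, ⟨hpure.1, hf_iff, hq_iff⟩, fun X => ?_⟩
  rw [IsIntermediate, hq_iff, hf_iff]
  omega

end ReedSolomon

end RampQSS
end

theorem mainTheorem7 {F : Type*} [Field F] [Fintype F] [DecidableEq F] (k L n : ℕ)
    (hL : 1 ≤ L) (hLk : L ≤ k) (hn : n + L = 2 * k) (hq : n ≤ Fintype.card F) :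
    -- the secret in the first `L` coefficients, evaluation at distinct nonzero points
    (∀ x : Fin n → F, Function.Injective x → (L < k → ∀ i, x i ≠ 0) →
      RampQSS.IsPureRampEncoding k L (RampQSS.encoder (RampQSS.firstPositions hLk) x)) ∧
    -- the secret in the last `L` coefficients, evaluation at arbitrary distinct points
    (∀ x : Fin n → F, Function.Injective x →
      RampQSS.IsPureRampEncoding k L (RampQSS.encoder (RampQSS.lastPositions hLk) x)) ∧
    -- the dimensions of the secret and of the shares
    RampQSS.hilbertDim (Fin L → F) = Fintype.card F ^ L ∧
    RampQSS.hilbertDim F = Fintype.card F ∧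
    -- optimality: a bound on all such schemes, which these dimensions attain
    (∀ (σ : Type*) (κ : Fin n → Type*) [Fintype σ] [∀ i, Fintype (κ i)]
      (W : Matrix σ σ ℂ →ₗ[ℂ] Matrix (∀ i, κ i) (∀ i, κ i) ℂ),
      RampQSS.IsThresholdRampScheme k L W →
        1 / (L : ℝ) * Real.log (RampQSS.hilbertDim σ) ≤
          1 / (n : ℝ) * ∑ i, Real.log (RampQSS.hilbertDim (κ i))) ∧
    1 / (L : ℝ) * Real.log (RampQSS.hilbertDim (Fin L → F)) =
      1 / (n : ℝ) * ∑ _i : Fin n, Real.log (RampQSS.hilbertDim F) := by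
  have hn0 : (n : ℝ) ≠ 0 := by exact_mod_cast (by omega : n ≠ 0)
  have hL0 : (L : ℝ) ≠ 0 := by exact_mod_cast (by omega : L ≠ 0)
  have hsecret : RampQSS.hilbertDim (Fin L → F) = Fintype.card F ^ L := by
    rw [RampQSS.hilbertDim_eq_card, Fintype.card_fun, Fintype.card_fin]
  refine ⟨fun x hx hx0 => RampQSS.isPureRampEncoding_encoder hL hLk hn hx fun Z hZ =>
      RampQSS.exists_firstPositions_polyEval hLk hx hx0 hZ,
    fun x hx => RampQSS.isPureRampEncoding_encoder hL hLk hn hx fun Z hZ =>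
      RampQSS.exists_lastPositions_polyEval hLk hx hZ,
    hsecret, RampQSS.hilbertDim_eq_card F,
    fun σ κ _ _ W hW => hW.log_hilbertDim_le hL hLk hn, ?_⟩
  rw [hsecret, Finset.sum_const, Finset.card_univ, Fintype.card_fin, nsmul_eq_mul,
    RampQSS.hilbertDim_eq_card, Nat.cast_pow, Real.log_pow, one_div, one_div,
    inv_mul_cancel_left₀ hL0, inv_mul_cancel_left₀ hn0]
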